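/- Let $S$ be a finite set, and let $\succeq$ be a qualitative probability on $2^S$: a complete and transitive relation on the subsets of $S$, with strict part $\succ$, such that * for all $A,B,C\subseteq S$ with $C\cap(A\cup B)=\varnothing$, $A\succeq B \iff A\cup C\succeq B\cup C$; * $A\subseteq B$ implies $B\succeq A$; * $S\succ\varnothing$. Identify each subset of $S$ with its indicator function, and let $\succeq^*$ be the induced relation on $\mathbb{Z}^S$: $f\succeq^* g$ if and only if $f=\mathbf 1_A$ and $g=\mathbf 1_B$ for some $A,B\subseteq S$ with $A\succeq B$. Let $\succ^*$ be its strict part ($f\succ^* g$ if and only if $f\succeq^* g$ and not $g\succeq^* f$). Let $\mathcal M$ be the family of all translations $f\mapsto f+h$ of $\mathbb{Z}^S$, with $h\in\mathbb{Z}^S$. For a relation $Q$ on $\mathbb{Z}^S$, its $\mathcal M$-closure $Q_{\mathcal M}$ is the relation defined by: $f' \mathrel{Q_{\mathcal M}} g'$ if and only if $f'=\omega(f)$ and $g'=\omega(g)$ for some $\omega\in\mathcal M$ and some $f,g$ with $f \mathrel{Q} g$. Then the following are equivalent: 1. there is a probability measure $\mu$ on $S$, defined on all subsets of $S$, such that for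 all $A,B\subseteq S$, $A\succeq B\iff\mu(A)\ge\mu(B)$; 2. the $\mathcal M$-closure $\langle\succeq^*_{\mathcal M},\succ^*_{\mathcal M}\rangle$ is acyclic: there do not exist $N\ge 0$ and $f_0,\dots,f_N\in\mathbb{Z}^S$ with $$f_0\succeq^*_{\mathcal M} f_1\succeq^*_{\mathcal M}\cdots\succeq^*_{\mathcal M} f_N\succ^*_{\mathcal M} f_0 .$$ -/

import Mathlib

namespace InvPref

/-- The strict (asymmetric) part `x ≻ y` of a relation `x ≽ y`. -/
def StrictPart {X : Type*} (R : X → X → Prop) (x y : X) : Prop :=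
  R x y ∧ ¬ R y x

/-- The `M`-closure of a relation `R`, for a family `M` of transformations of `X`: it relates
`ω x` to `ω y` whenever `ω ∈ M` and `R x y`. -/
def MClosure {X : Type*} (M : Set (X → X)) (R : X → X → Prop) (x' y' : X) : Prop :=
  ∃ ω ∈ M, ∃ x y : X, R x y ∧ ω x = x' ∧ ω y = y'

/-- A pair of relations (weak `R`, strict `P`) is acyclic if there is no cycle
`x₀ R x₁ R ⋯ R x_N P x₀`, where `N ≥ 0`. -/
def AcyclicPair {X : Type*} (R P : X → X → Prop) : Prop :=
  ¬ ∃ (N : ℕ) (x : Fin (N + 1) → X),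
    (∀ i : Fin N, R (x i.castSucc) (x i.succ)) ∧ P (x (Fin.last N)) (x 0)

/-- `R A B` reads "`A` is at least as likely as `B`". -/
structure IsQualitativeProbability {S : Type*} (R : Set S → Set S → Prop) : Prop where
  complete : ∀ A B : Set S, R A B ∨ R B A
  transitive : ∀ A B C : Set S, R A B → R B C → R A C
  additive : ∀ A B C : Set S, Disjoint C (A ∪ B) → (R A B ↔ R (A ∪ C) (B ∪ C))
  monotone : ∀ A B : Set S, A ⊆ B → R B A
  nontrivial : StrictPart R Set.univ ∅

/-- `R` is represented by a probability measure on the σ-algebra of all subsets of `S`. -/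
def IsProbabilisticallySophisticated {S : Type*} (R : Set S → Set S → Prop) : Prop :=
  ∃ μ : @MeasureTheory.Measure S ⊤,
    @MeasureTheory.IsProbabilityMeasure S ⊤ μ ∧ ∀ A B : Set S, R A B ↔ μ B ≤ μ A

/-- The indicator function of an event, as an integer-valued function. -/
noncomputable def ind {S : Type*} (A : Set S) : S → ℤ := A.indicator 1

/-- The order that `R` induces on the integer-valued functions, events being identified with their
indicator functions; functions that are not indicators are not compared with anything. -/
def starOrder {S : Type*} (R : Set S → Set S → Prop) (f g : S → ℤ) : Prop :=
  ∃ A B : Set S, R A B ∧ ind A = f ∧ ind B = g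

/-- The family of all integer translations `f ↦ f + g` of `S → ℤ`. -/
def translations (S : Type*) : Set ((S → ℤ) → (S → ℤ)) :=
  Set.range fun g : S → ℤ => fun f : S → ℤ => f + g

end InvPref

/-! Translation closure makes a comparison depend only on the difference of its two functions
(`mClosure_translations`). Given a measure, integration is a utility for the closed relations, which
excludes cycles. Conversely, suppose a strict comparison A ≻ B is positive under no weights that
respect all weak ones. Farkas over ℚ, after clearing denominators, gives N > 0 copies of 1_A - 1_B
plus natural multiples of weak differences summing to zero. Traversed one difference at a time, this
sum is a forbidden cycle. So each strict comparison has its own good weights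
(`exists_weights_of_strict`); adding them up represents the relation, and normalizing gives the
measure. -/

/-- **Farkas' lemma** over a linearly ordered field: if a linear functional `c` is nonpositive
wherever all members of a finite family `a` are, then it is a nonnegative combination of `a`. -/
theorem InvPref.farkas {K V ι : Type*} [Field K] [LinearOrder K] [IsStrictOrderedRing K]
    [AddCommGroup V] [Module K V] (s : Finset ι) (a : ι → Module.Dual K V) (c : Module.Dual K V)
    (h : ∀ x, (∀ i ∈ s, a i x ≤ 0) → c x ≤ 0) :
    ∃ l : ι → K, (∀ i, 0 ≤ l i) ∧ c = ∑ i ∈ s, l i • a i := by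
  classical
  induction s using Finset.induction_on generalizing a c with
  | empty =>
    refine ⟨0, fun _ => le_rfl, LinearMap.ext fun x => ?_⟩
    have h1 := h x (by simp)
    have h2 := h (-x) (by simp)
    simp only [map_neg, Finset.sum_empty, LinearMap.zero_apply] at *
    linarith
  | insert m s hm ih =>
    by_cases hs : ∀ x, (∀ i ∈ s, a i x ≤ 0) → c x ≤ 0
    · obtain ⟨l, hl, hc⟩ := ih a c hs
      refine ⟨Function.update l m 0, fun i => ?_, ?_⟩
      · by_cases hi : i = m
        · simp [hi]
        · simpa [hi] using hl i
      · rw [Finset.sum_insert hm, Function.update_self, zero_smul, zero_add, hc]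
        refine Finset.sum_congr rfl fun i hi => ?_
        rw [Function.update_of_ne (ne_of_mem_of_not_mem hi hm)]
    · push Not at hs
      obtain ⟨y, hy, hcy⟩ := hs
      have hmy : 0 < a m y := by
        by_contra! hle
        exact absurd (h y (Finset.forall_mem_insert _ _ _ |>.2 ⟨hle, hy⟩)) (not_le.2 hcy)
      set z := (a m y)⁻¹ • y with hz
      have hmz : a m z = 1 := by simp [hz, hmy.ne']
      have hcz : 0 < c z := by
        simp only [hz, map_smul, smul_eq_mul]; positivity
      have haz : ∀ i ∈ s, a i z ≤ 0 := fun i hi => by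
        simp only [hz, map_smul, smul_eq_mul]
        exact mul_nonpos_of_nonneg_of_nonpos (by positivity) (hy i hi)
      -- Projecting along `z` onto the kernel of `a m` makes the constraint `m` hold automatically,
      -- so the induction hypothesis applies to the projected functionals.
      obtain ⟨l, hl, hc⟩ := ih (fun i => a i - a i z • a m) (c - c z • a m) (by
        intro x hx
        have := h (x - a m x • z) (Finset.forall_mem_insert _ _ _ |>.2 ⟨by simp [hmz],
          fun i hi => by simpa [mul_comm] using hx i hi⟩)
        simpa [mul_comm] using this)
      have hcoef : 0 ≤ c z - ∑ i ∈ s, l i * a i z := by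
        have : ∑ i ∈ s, l i * a i z ≤ 0 :=
          Finset.sum_nonpos fun i hi => mul_nonpos_of_nonneg_of_nonpos (hl i) (haz i hi)
        linarith
      refine ⟨Function.update l m (c z - ∑ i ∈ s, l i * a i z), fun i => ?_, ?_⟩
      · by_cases hi : i = m
        · simpa [hi] using hcoef
        · simpa [hi] using hl i
      · rw [Finset.sum_insert hm, Function.update_self]
        have : ∀ i ∈ s, Function.update l m (c z - ∑ i ∈ s, l i * a i z) i • a i = l i • a i :=
          fun i hi => by rw [Function.update_of_ne (ne_of_mem_of_not_mem hi hm)]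
        rw [Finset.sum_congr rfl this]
        simp only [smul_sub, Finset.sum_sub_distrib, smul_smul, ← Finset.sum_smul] at hc
        ext x
        have hcx := DFunLike.congr_fun hc x
        simp only [LinearMap.sub_apply, LinearMap.add_apply, LinearMap.smul_apply,
          smul_eq_mul] at hcx ⊢
        linear_combination hcx

/-- A finite family of nonnegative rationals has a common denominator. -/
theorem InvPref.exists_nat_multiple {ι : Type*} (s : Finset ι) (l : ι → ℚ) (hl : ∀ i, 0 ≤ l i) :
    ∃ (N : ℕ) (n : ι → ℕ), 0 < N ∧ ∀ i ∈ s, (n i : ℚ) = N * l i := by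
  refine ⟨∏ i ∈ s, (l i).den, fun i => ((∏ i ∈ s, (l i).den : ℕ) * l i).num.toNat,
    Finset.prod_pos fun i _ => (l i).den_pos, fun i hi => ?_⟩
  obtain ⟨k, hk⟩ := Finset.dvd_prod_of_mem (fun i => (l i).den) hi
  have h1 : ((∏ i ∈ s, (l i).den : ℕ) : ℚ) * l i = ((k * (l i).num : ℤ) : ℚ) := by
    rw [hk]; push_cast
    rw [mul_right_comm, mul_comm ((l i).den : ℚ), Rat.mul_den_eq_num, mul_comm]
  have h2 : 0 ≤ (k : ℤ) * (l i).num := mul_nonneg (by positivity) (Rat.num_nonneg.2 (hl i))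
  simp only [h1, Rat.num_intCast]
  exact_mod_cast Int.toNat_of_nonneg h2

namespace InvPref

theorem ind_injective {S : Type*} : Function.Injective (ind : Set S → S → ℤ) := by
  intro A B h
  ext s
  have := congrFun h s
  by_cases hA : s ∈ A <;> by_cases hB : s ∈ B <;> simp_all [ind]

theorem strictPart_starOrder {S : Type*} {R : Set S → Set S → Prop} {f g : S → ℤ} :
    StrictPart (starOrder R) f g ↔ ∃ A B, StrictPart R A B ∧ ind A = f ∧ ind B = g := by
  constructor
  · rintro ⟨⟨A, B, h, rfl, rfl⟩, hn⟩
    exact ⟨A, B, ⟨h, fun h' => hn ⟨B, A, h', rfl, rfl⟩⟩, rfl, rfl⟩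
  · rintro ⟨A, B, ⟨h, hn⟩, rfl, rfl⟩
    refine ⟨⟨A, B, h, rfl, rfl⟩, ?_⟩
    rintro ⟨B', A', h', hB, hA⟩
    rw [ind_injective hB, ind_injective hA] at h'
    exact hn h'

/-- A relation between indicator functions, closed under translations, only depends on the
difference of its arguments. -/
theorem mClosure_translations {S : Type*} {Q : (S → ℤ) → (S → ℤ) → Prop}
    {R : Set S → Set S → Prop} (hQ : ∀ f g, Q f g ↔ ∃ A B, R A B ∧ ind A = f ∧ ind B = g)
    {f g : S → ℤ} :
    MClosure (translations S) Q f g ↔ ∃ A B, R A B ∧ f - g = ind A - ind B := by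
  constructor
  · rintro ⟨_, ⟨h, rfl⟩, x, y, hxy, rfl, rfl⟩
    obtain ⟨A, B, hAB, rfl, rfl⟩ := (hQ x y).1 hxy
    exact ⟨A, B, hAB, by simp⟩
  · rintro ⟨A, B, hAB, h⟩
    refine ⟨_, ⟨f - ind A, rfl⟩, ind A, ind B, (hQ _ _).2 ⟨A, B, hAB, rfl, rfl⟩, by simp, ?_⟩
    show ind B + (f - ind A) = g
    linear_combination h

theorem mClosure_weak {S : Type*} {R : Set S → Set S → Prop} {f g : S → ℤ} :
    MClosure (translations S) (starOrder R) f g ↔ ∃ A B, R A B ∧ f - g = ind A - ind B :=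
  mClosure_translations fun _ _ => Iff.rfl

theorem mClosure_strict {S : Type*} {R : Set S → Set S → Prop} {f g : S → ℤ} :
    MClosure (translations S) (StrictPart (starOrder R)) f g ↔
      ∃ A B, StrictPart R A B ∧ f - g = ind A - ind B :=
  mClosure_translations (R := StrictPart R) fun _ _ => strictPart_starOrder

theorem AcyclicPair.not_of_reflTransGen {X : Type*} {R P : X → X → Prop} (h : AcyclicPair R P)
    {x y : X} (hxy : Relation.ReflTransGen R x y) : ¬ P y x := by
  intro hP
  have key : ∃ (N : ℕ) (f : Fin (N + 1) → X),
      (∀ i : Fin N, R (f i.castSucc) (f i.succ)) ∧ f (Fin.last N) = y ∧ f 0 = x := by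
    clear hP
    induction hxy with
    | refl => exact ⟨0, fun _ => x, fun i => i.elim0, rfl, rfl⟩
    | @tail b c _ hbc ih =>
      obtain ⟨N, f, hf, hl, h0⟩ := ih
      refine ⟨N + 1, Fin.snoc f c, fun i => ?_, by simp, ?_⟩
      · refine Fin.lastCases ?_ (fun j => ?_) i
        · rw [Fin.succ_last, Fin.snoc_last, Fin.snoc_castSucc, hl]; exact hbc
        · rw [Fin.succ_castSucc, Fin.snoc_castSucc, Fin.snoc_castSucc]; exact hf j
      · rw [← Fin.castSucc_zero, Fin.snoc_castSucc, h0]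
  obtain ⟨N, f, hf, rfl, rfl⟩ := key
  exact h ⟨N, f, hf, hP⟩

/-- A pair of relations is acyclic if it has a real-valued utility. -/
theorem AcyclicPair.of_utility {X : Type*} {R P : X → X → Prop} (u : X → ℝ)
    (hR : ∀ x y, R x y → u y ≤ u x) (hP : ∀ x y, P x y → u y < u x) : AcyclicPair R P := by
  rintro ⟨N, x, hx, hlast⟩
  have key : ∀ i : Fin (N + 1), u (x i) ≤ u (x 0) := fun i => by
    induction i using Fin.induction with
    | zero => exact le_rfl
    | succ i ih => exact (hR _ _ (hx i)).trans ih
  exact absurd (hP _ _ hlast) (not_lt.2 (key _))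

/-- The value that the weights `x` give to the difference of the indicators of two events. -/
noncomputable def diffForm {S : Type*} [Fintype S] (w : Set S × Set S) :
    Module.Dual ℚ (S → ℚ) :=
  ∑ s, ((ind w.1 s - ind w.2 s : ℤ) : ℚ) • LinearMap.proj s

theorem diffForm_apply {S : Type*} [Fintype S] (w : Set S × Set S) (x : S → ℚ) :
    diffForm w x = ∑ s, ((ind w.1 s - ind w.2 s : ℤ) : ℚ) * x s := by
  simp [diffForm, LinearMap.sum_apply]

theorem diffForm_swap {S : Type*} [Fintype S] (A B : Set S) (x : S → ℚ) :
    diffForm (B, A) x = -diffForm (A, B) x := by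
  rw [diffForm_apply, diffForm_apply, ← Finset.sum_neg_distrib]
  refine Finset.sum_congr rfl fun s _ => ?_
  push_cast; ring

theorem diffForm_single {S : Type*} [Fintype S] [DecidableEq S] (w : Set S × Set S) (s : S) :
    diffForm w (Pi.single s 1) = ((ind w.1 s - ind w.2 s : ℤ) : ℚ) := by
  simp [diffForm_apply, Pi.single_apply]

/-- Translation invariance lets each weak difference be subtracted at any point, as often as
desired; this turns a linear relation into a path. -/
theorem reflTransGen_sub_sum {S : Type*} {R : Set S → Set S → Prop}
    (W : Finset (Set S × Set S)) (hW : ∀ w ∈ W, R w.1 w.2) (n : Set S × Set S → ℕ) (f : S → ℤ) :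
    Relation.ReflTransGen (MClosure (translations S) (starOrder R)) f
      (f - ∑ w ∈ W, n w • (ind w.1 - ind w.2)) := by
  classical
  induction W using Finset.induction_on generalizing f with
  | empty => simpa using Relation.ReflTransGen.refl
  | insert w W hw ih =>
    have hstep : ∀ (k : ℕ) (g : S → ℤ),
        Relation.ReflTransGen (MClosure (translations S) (starOrder R)) g
          (g - k • (ind w.1 - ind w.2)) := by
      intro k g
      induction k with
      | zero => simpa using Relation.ReflTransGen.refl
      | succ k ihk =>
        exact ihk.tail (mClosure_weak.2
          ⟨w.1, w.2, hW w (Finset.mem_insert_self _ _), by rw [succ_nsmul]; abel⟩)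
    rw [Finset.sum_insert hw, ← sub_sub]
    exact (hstep _ _).trans (ih (fun v hv => hW v (Finset.mem_insert_of_mem hv)) _)

/-- Under acyclicity, each strict comparison is respected by some weights that also respect all
weak comparisons. -/
theorem exists_weights_of_strict {S : Type*} [Fintype S] {R : Set S → Set S → Prop}
    (h : AcyclicPair (MClosure (translations S) (starOrder R))
      (MClosure (translations S) (StrictPart (starOrder R))))
    {A B : Set S} (hAB : StrictPart R A B) :
    ∃ x : S → ℚ, (∀ C D, R C D → 0 ≤ diffForm (C, D) x) ∧ 0 < diffForm (A, B) x := by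
  classical
  by_contra! hno
  let W : Finset (Set S × Set S) := Finset.univ.filter fun w => R w.1 w.2
  have hW : ∀ w ∈ W, R w.1 w.2 := fun w hw => (Finset.mem_filter.1 hw).2
  obtain ⟨l, hl, hc⟩ := farkas W (fun w => -diffForm w) (diffForm (A, B)) fun x hx =>
    hno x fun C D hCD => by
      simpa using hx (C, D) (Finset.mem_filter.2 ⟨Finset.mem_univ _, hCD⟩)
  obtain ⟨N, n, hN, hn⟩ := exists_nat_multiple W l hl
  have hsum : N • (ind A - ind B) + ∑ w ∈ W, n w • (ind w.1 - ind w.2) = (0 : S → ℤ) := by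
    ext s
    -- Evaluation at the unit vector of `s` reads off the coefficient at `s`; the factor `N` clears
    -- denominators.
    have hs := congrArg (fun L : Module.Dual ℚ (S → ℚ) => (N : ℚ) * L (Pi.single s 1)) hc
    simp only [LinearMap.sum_apply, LinearMap.smul_apply, LinearMap.neg_apply, diffForm_single,
      smul_eq_mul, Finset.mul_sum] at hs
    have hs' : ∑ w ∈ W, (N : ℚ) * (l w * -((ind w.1 s - ind w.2 s : ℤ) : ℚ)) =
        -∑ w ∈ W, (n w : ℚ) * ((ind w.1 s - ind w.2 s : ℤ) : ℚ) := by
      rw [← Finset.sum_neg_distrib]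
      refine Finset.sum_congr rfl fun w hw => ?_
      rw [hn w hw]; ring
    rw [hs', eq_neg_iff_add_eq_zero] at hs
    simp only [Pi.add_apply, Finset.sum_apply, nsmul_eq_mul,
      Pi.zero_apply]
    exact_mod_cast hs
  -- Only `N - 1` copies of the pair `(A, B)` are spent as weak steps: by `hsum` the path from 0
  -- then ends at `ind A - ind B`, and the last copy is the strict step back to 0.
  have hchain := (reflTransGen_sub_sum {(A, B)} (by simpa using hAB.1) (fun _ => N - 1) 0).trans
    (reflTransGen_sub_sum W hW n _)
  refine h.not_of_reflTransGen hchain (mClosure_strict.2 ⟨A, B, hAB, ?_⟩)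
  obtain ⟨M, rfl⟩ : ∃ M, N = M + 1 := ⟨N - 1, by omega⟩
  rw [Finset.sum_singleton, Nat.add_sub_cancel]
  rw [succ_nsmul] at hsum
  linear_combination -hsum

/-- Under acyclicity, some weights represent the relation. -/
theorem exists_weights {S : Type*} [Fintype S] {R : Set S → Set S → Prop}
    (hcomp : ∀ A B, R A B ∨ R B A)
    (h : AcyclicPair (MClosure (translations S) (starOrder R))
      (MClosure (translations S) (StrictPart (starOrder R)))) :
    ∃ x : S → ℚ, ∀ A B, R A B ↔ 0 ≤ diffForm (A, B) x := by
  classical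
  choose! x hx hpos using fun (w : Set S × Set S) (hw : StrictPart R w.1 w.2) =>
    exists_weights_of_strict h hw
  let P : Finset (Set S × Set S) := Finset.univ.filter fun w => StrictPart R w.1 w.2
  have hP : ∀ w ∈ P, StrictPart R w.1 w.2 := fun w hw => (Finset.mem_filter.1 hw).2
  -- Every summand is nonnegative on all weak comparisons, and each strict comparison is made
  -- positive by its own summand.
  refine ⟨∑ w ∈ P, x w, fun A B => ⟨fun hAB => ?_, fun hAB => ?_⟩⟩
  · rw [map_sum]
    exact Finset.sum_nonneg fun w hw => hx w (hP w hw) _ _ hAB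
  · by_contra hn
    have hBA : StrictPart R B A := ⟨(hcomp A B).resolve_left hn, hn⟩
    have : 0 < diffForm (B, A) (∑ w ∈ P, x w) := by
      rw [map_sum]
      exact Finset.sum_pos' (fun w hw => hx w (hP w hw) _ _ hBA.1)
        ⟨(B, A), Finset.mem_filter.2 ⟨Finset.mem_univ _, hBA⟩, hpos (B, A) hBA⟩
    rw [diffForm_swap] at this
    linarith

theorem diffForm_eq_sub {S : Type*} [Fintype S] (A B : Set S) (x : S → ℚ) :
    diffForm (A, B) x = ∑ s, A.indicator x s - ∑ s, B.indicator x s := by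
  classical
  rw [diffForm_apply, ← Finset.sum_sub_distrib]
  refine Finset.sum_congr rfl fun s _ => ?_
  simp only [ind, Set.indicator_apply, Pi.one_apply]
  split_ifs <;> simp

/-- Nonnegative weights, not all zero, represent the same relation as some probability measure. -/
theorem exists_measure_of_weights {S : Type*} [Fintype S] (x : S → ℚ) (hx : ∀ s, 0 ≤ x s)
    (hpos : 0 < ∑ s, x s) :
    ∃ μ : @MeasureTheory.Measure S ⊤, @MeasureTheory.IsProbabilityMeasure S ⊤ μ ∧
      ∀ A B : Set S, μ B ≤ μ A ↔ 0 ≤ diffForm (A, B) x := by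
  classical
  let : MeasurableSpace S := ⊤
  have hq : ∀ s, 0 ≤ ((x s / ∑ t, x t : ℚ) : ℝ) := fun s => by
    exact_mod_cast div_nonneg (hx s) hpos.le
  let p : PMF S := PMF.ofFintype (fun s => ENNReal.ofReal ((x s / ∑ t, x t : ℚ) : ℝ)) (by
    rw [← ENNReal.ofReal_sum_of_nonneg fun s _ => hq s, ← Rat.cast_sum, ← Finset.sum_div,
      div_self hpos.ne', Rat.cast_one, ENNReal.ofReal_one])
  refine ⟨p.toMeasure, inferInstance, fun A B => ?_⟩
  have hμ : ∀ A : Set S, p.toMeasure A =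
      ENNReal.ofReal (((∑ s, A.indicator x s) / ∑ t, x t : ℚ) : ℝ) := fun A => by
    rw [PMF.toMeasure_apply_fintype p, Finset.sum_div,
      Rat.cast_sum, ENNReal.ofReal_sum_of_nonneg]
    · refine Finset.sum_congr rfl fun s _ => ?_
      by_cases hs : s ∈ A <;> simp [hs, p]
    · intro s _
      by_cases hs : s ∈ A
      · simpa [hs] using hq s
      · simp [hs]
  have hA : 0 ≤ ∑ s, A.indicator x s :=
    Finset.sum_nonneg fun s _ => Set.indicator_nonneg (fun s _ => hx s) s
  rw [hμ, hμ, ENNReal.ofReal_le_ofReal_iff (by exact_mod_cast div_nonneg hA hpos.le),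
    Rat.cast_le, div_le_div_iff_of_pos_right hpos, diffForm_eq_sub, sub_nonneg]

end InvPref

open InvPref in
theorem mainTheorem5 {S : Type*} [Finite S] (R : Set S → Set S → Prop)
    (hR : InvPref.IsQualitativeProbability R) :
    InvPref.IsProbabilisticallySophisticated R ↔
      InvPref.AcyclicPair
        (InvPref.MClosure (InvPref.translations S) (InvPref.starOrder R))
        (InvPref.MClosure (InvPref.translations S) (InvPref.StrictPart (InvPref.starOrder R))) := by
  classical
  have := Fintype.ofFinite S
  constructor
  · rintro ⟨μ, hμ, hrep⟩
    let : MeasurableSpace S := ⊤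
    -- The integral against `μ`: additive, and equal to the measure on indicators.
    let u : (S → ℤ) → ℝ := fun f => ∑ s, (f s : ℝ) * μ.real {s}
    have hu : ∀ f g, u (f - g) = u f - u g := fun f g => by
      simp only [u, ← Finset.sum_sub_distrib, ← sub_mul]
      simp
    have hind : ∀ A, u (ind A) = μ.real A := fun A => by
      have : μ.real A = ∑ s ∈ A.toFinset, μ.real {s} := by
        rw [MeasureTheory.sum_measureReal_singleton, Set.coe_toFinset]
      rw [this, ← Set.filter_mem_univ_eq_toFinset, Finset.sum_filter]
      exact Finset.sum_congr rfl fun s _ => by by_cases hs : s ∈ A <;> simp [ind, hs]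
    have hle : ∀ A B, μ.real B ≤ μ.real A ↔ R A B := fun A B => by
      rw [hrep, MeasureTheory.measureReal_def, MeasureTheory.measureReal_def,
        ENNReal.toReal_le_toReal (MeasureTheory.measure_ne_top _ _)
          (MeasureTheory.measure_ne_top _ _)]
    refine AcyclicPair.of_utility u (fun f g hfg => ?_) (fun f g hfg => ?_)
    · obtain ⟨A, B, hAB, h⟩ := mClosure_weak.1 hfg
      have h' := congrArg u h
      rw [hu, hu, hind, hind] at h'
      linarith [(hle A B).2 hAB]
    · obtain ⟨A, B, hAB, h⟩ := mClosure_strict.1 hfg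
      have h' := congrArg u h
      rw [hu, hu, hind, hind] at h'
      linarith [not_le.1 (mt (hle B A).1 hAB.2)]
  · intro h
    obtain ⟨x, hx⟩ := exists_weights hR.complete h
    have hnonneg : ∀ s, 0 ≤ x s := fun s => by
      have := (hx {s} ∅).1 (hR.monotone _ _ (Set.empty_subset _))
      simpa [diffForm_eq_sub, Set.indicator_apply] using this
    have hpos : 0 < ∑ s, x s := by
      have := mt (hx ∅ Set.univ).2 hR.nontrivial.2
      simpa [diffForm_eq_sub] using this
    obtain ⟨μ, hμ, hrep⟩ := exists_measure_of_weights x hnonneg hpos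
    exact ⟨μ, hμ, fun A B => (hx A B).trans (hrep A B).symm⟩
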